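/- Let $n,k$ be integers with $1\le k<n/2$, and let $\Sigma=\Sigma_k\subset\mathbb{R}^n$ be the set of vectors with at most $k$ nonzero entries, where $\mathbb{R}^n$ carries the Euclidean inner product $\langle\cdot,\cdot\rangle$ and norm $\|\cdot\|_2$. For a set $A\subseteq\mathbb{R}^n$ the atomic "norm" is $\|x\|_A:=\inf\{t\ge 0 : x\in t\cdot\overline{\mathrm{conv}}(A)\}$ (equal to $+\infty$ if there is no such $t$), and $\|\cdot\|_\Sigma:=\|\cdot\|_{\Sigma\cap S(1)}$, where $S(1)$ is the Euclidean unit sphere. For $R:\mathbb{R}^n\to\mathbb{R}$, the symmetrized descent cone of $R$ on $\Sigma$ is $$\mathcal{T}_R(\Sigma):=\bigcup_{x\in\Sigma}\{\gamma z : \gamma\in\mathbb{R},\ z\in\mathbb{R}^n,\ R(x+z)\le R(x)\},$$ and the explicit sufficient RIP constant of $R$ is $$\delta^{\mathtt{suff}}_\Sigma(R):=\inf_{z\in\mathcal{T}_R(\Sigma)\setminus\{0\}}\ \sup_{x\in\Sigma\setminus\{0\}}\ \frac{-\langle x,z\rangle}{\|x\|_2\sqrt{\|x+z\|_\Sigma^2-\|x\|_2^2-2\langle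 x,z\rangle}}.$$ Let $\mathcal{C}$ be the set of all convex, continuous, coercive functions $R:\mathbb{R}^n\to\mathbb{R}$ (coercive: $R(x)\to+\infty$ as $\|x\|_2\to\infty$), and let $\mathcal{C}_\Sigma$ be the set of those positively homogeneous $R\in\mathcal{C}$ that are of the form $R=\|\cdot\|_A$ for some $A\subseteq\Sigma$. Then $\|\cdot\|_1\in\mathcal{C}$ and $$\delta^{\mathtt{suff}}_\Sigma(\|\cdot\|_1)=\sup_{R\in\mathcal{C}}\delta^{\mathtt{suff}}_\Sigma(R)=\frac{1}{\sqrt2}.$$ Moreover, if $k=1$, the set of maximizers of $\delta^{\mathtt{suff}}_\Sigma$ over $\mathcal{C}_\Sigma$ is exactly $\{\lambda\|\cdot\|_1 : \lambda>0\}$. -/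

import Mathlib

open Filter Topology Pointwise

/-- The atomic "norm" induced by a set of atoms `A`, as an extended real:
`inf {t ≥ 0 : x ∈ t • closure (conv A)}`, equal to `+∞` if there is no such `t`. -/
noncomputable def atomicNorm {E : Type*} [NormedAddCommGroup E] [InnerProductSpace ℝ E]
    (A : Set E) (x : E) : EReal :=
  ⨅ t ∈ {t : ℝ | 0 ≤ t ∧ x ∈ t • closure (convexHull ℝ A)}, (t : EReal)

/-- The norm `‖·‖_Σ` induced by a model set: the atomic norm whose atoms are the unit vectors
of the model. -/
noncomputable def modelNorm {E : Type*} [NormedAddCommGroup E] [InnerProductSpace ℝ E]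
    (S : Set E) (x : E) : EReal :=
  atomicNorm (S ∩ Metric.sphere 0 1) x

/-- The symmetrized descent cone of a real-valued regularizer `R` at `x`. -/
def descentConeAt {E : Type*} [NormedAddCommGroup E] [InnerProductSpace ℝ E]
    (R : E → ℝ) (x : E) : Set E :=
  {y | ∃ (γ : ℝ) (z : E), R (x + z) ≤ R x ∧ y = γ • z}

/-- The union of the symmetrized descent cones of `R` at the points of `S`. -/
def descentCone {E : Type*} [NormedAddCommGroup E] [InnerProductSpace ℝ E]
    (R : E → ℝ) (S : Set E) : Set E :=
  ⋃ x ∈ S, descentConeAt R x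

/-- The quotient `-⟨x,z⟩ / (‖x‖ √(‖x+z‖_Σ² - ‖x‖² - 2⟨x,z⟩))`. The model norm is finite
everywhere for sparse vectors, see `modelNorm_sparseVectors_ne_top`. -/
noncomputable def suffRatio {E : Type*} [NormedAddCommGroup E] [InnerProductSpace ℝ E]
    (S : Set E) (x z : E) : ℝ :=
  -(inner ℝ x z) /
    (‖x‖ * √((modelNorm S (x + z)).toReal ^ 2 - ‖x‖ ^ 2 - 2 * inner ℝ x z))

/-- The explicit sufficient RIP constant of the regularizer `R` for the model `S`. -/
noncomputable def deltaSuff {E : Type*} [NormedAddCommGroup E] [InnerProductSpace ℝ E]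
    (S : Set E) (R : E → ℝ) : EReal :=
  ⨅ z ∈ descentCone R S \ {0}, ⨆ x ∈ S \ {0}, (suffRatio S x z : EReal)

/-- The class of coercive continuous convex real-valued functions. -/
def coerciveConvex (E : Type*) [NormedAddCommGroup E] [InnerProductSpace ℝ E] :
    Set (E → ℝ) :=
  {R | ConvexOn ℝ Set.univ R ∧ Continuous R ∧ Tendsto R (Bornology.cobounded E) atTop}

/-- The class of coercive, continuous, (convex,) positively homogeneous real-valued functions
that are atomic norms with atoms in `S`. -/
def coerciveAtomic {E : Type*} [NormedAddCommGroup E] [InnerProductSpace ℝ E]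
    (S : Set E) : Set (E → ℝ) :=
  {R | R ∈ coerciveConvex E ∧ (∀ (t : ℝ) (x : E), 0 ≤ t → R (t • x) = t * R x) ∧
    ∃ A ⊆ S, ∀ x, (R x : EReal) = atomicNorm A x}

/-- The vectors of `ℝⁿ` with at most `k` nonzero entries. -/
def sparseVectors (n k : ℕ) : Set (EuclideanSpace ℝ (Fin n)) :=
  {x | {i | x i ≠ 0}.ncard ≤ k}

/-- The `ℓ¹`-norm on `ℝⁿ`. -/
noncomputable def l1Norm (n : ℕ) (x : EuclideanSpace ℝ (Fin n)) : ℝ := ∑ i, |x i|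

theorem modelNorm_sparseVectors_ne_top {n k : ℕ} (hk : 1 ≤ k) (hn : 1 ≤ n)
    (v : EuclideanSpace ℝ (Fin n)) :
    modelNorm (sparseVectors n k) v ≠ ⊤ ∧ modelNorm (sparseVectors n k) v ≠ ⊥ := by
  have hmem : ∀ (i : Fin n) (s : ℝ), |s| = 1 → EuclideanSpace.single i s ∈
      sparseVectors n k ∩ Metric.sphere 0 1 := by
    intro i s hs
    refine ⟨?_, by simp [hs]⟩
    have hsub : {j | (EuclideanSpace.single i s : EuclideanSpace ℝ (Fin n)) j ≠ 0} ⊆ {i} := by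
      intro j hj
      by_contra h
      apply hj
      have h' : j ≠ i := h
      simp [h']
    have := Set.ncard_le_ncard hsub (Set.finite_singleton i)
    rw [Set.ncard_singleton] at this
    exact this.trans hk
  have key : ∃ t : ℝ, 0 ≤ t ∧ v ∈ t •
      closure (convexHull ℝ (sparseVectors n k ∩ Metric.sphere 0 1)) := by
    set s : ℝ := ∑ i, |v i| with hs
    have hs0 : 0 ≤ s := Finset.sum_nonneg fun i _ => abs_nonneg _
    refine ⟨s, hs0, ?_⟩
    have hsum : ∀ i : Fin n, v i = |v i| * (if 0 ≤ v i then 1 else -1) := by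
      intro i
      split_ifs with h
      · simp [abs_of_nonneg h]
      · simp [abs_of_neg (not_le.mp h)]
    rcases hs0.eq_or_lt with h0 | hpos
    · have hv : v = 0 := by
        ext i
        have := (Finset.sum_eq_zero_iff_of_nonneg (fun i _ => abs_nonneg (v i))).1 h0.symm i
          (Finset.mem_univ i)
        simpa using this
      rw [← h0, hv]
      exact ⟨_, subset_closure (subset_convexHull ℝ _ (hmem ⟨0, hn⟩ 1 (by simp))), by simp⟩
    · refine ⟨∑ i, (|v i| / s) • EuclideanSpace.single i (if 0 ≤ v i then (1 : ℝ) else -1),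
        subset_closure ?_, ?_⟩
      · refine (convex_convexHull ℝ _).sum_mem (fun i _ => by positivity) ?_ fun i _ =>
          subset_convexHull ℝ _ (hmem i _ (by split_ifs <;> simp))
        rw [← Finset.sum_div, ← hs, div_self hpos.ne']
      · ext j
        simp only [PiLp.smul_apply, WithLp.ofLp_sum, Finset.sum_apply, smul_eq_mul,
          WithLp.ofLp_smul, Pi.smul_apply]
        rw [Finset.sum_eq_single j]
        · conv_rhs => rw [hsum j]
          simp
          field_simp
        · intro i _ hij
          simp [hij.symm]
        · simp
  obtain ⟨t, ht, htv⟩ := key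
  constructor
  · refine ne_of_lt (lt_of_le_of_lt (iInf₂_le t ⟨ht, htv⟩) (EReal.coe_lt_top t))
  · refine ne_of_gt (lt_of_lt_of_le (EReal.bot_lt_zero) ?_)
    exact le_iInf₂ fun s hs => by exact_mod_cast hs.1

/-! ### Atomic norms, duality, and bounds on the sufficient constant. -/

section Atomic

variable {E : Type*} [NormedAddCommGroup E] [InnerProductSpace ℝ E]

/-! Upper bound, for every `R`: take `z = 1_T - 1_U` with `T`, `U` disjoint of size `k`. Whichever
of the two indicators has the larger value of `R`, `z` is a symmetrized descent direction
(`sub_mem_descentCone`). Since the model norm dominates the Euclidean one, the radicand is at least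
`‖z‖² = 2k`, while Cauchy–Schwarz on the support of `x` bounds the numerator by `‖x‖√k`.

Lower bound for `ℓ¹`: given a descent vector `z` with `k` largest entries on `T`, test with `x =
-z_T`. The tail has `ℓ¹`-norm at most `s = ‖z_T‖₁` and entries at most `s/k`, so
`modelNorm_toReal_le` bounds its model norm by `s/√k ≤ ‖z_T‖`. The radicand is then at most
`2‖z_T‖²`.

Uniqueness for `k = 1`: if `R` separates two signed unit vectors of different coordinates, the gap
leaves room for a third small entry in a descent vector. No entry then carries half the `ℓ¹`-mass,
which makes the constant smaller than `1/√2`. So `R` equals some `c` on all signed unit vectors;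
sublinearity gives `R ≤ c‖·‖₁`, and the reverse holds because the atoms are 1-sparse. -/

theorem le_atomicNorm_of_forall {A : Set E} {x : E} {c : ℝ}
    (h : ∀ t : ℝ, 0 ≤ t → x ∈ t • closure (convexHull ℝ A) → c ≤ t) :
    (c : EReal) ≤ atomicNorm A x :=
  le_iInf₂ fun t ht => by exact_mod_cast h t ht.1 ht.2

theorem atomicNorm_le {A : Set E} {x : E} {t : ℝ} (ht : 0 ≤ t)
    (hx : x ∈ t • closure (convexHull ℝ A)) : atomicNorm A x ≤ t :=
  iInf₂_le t ⟨ht, hx⟩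

/-- A continuous convex positively homogeneous function that is at most `1` on the atoms is
dominated by the atomic norm. -/
theorem le_atomicNorm {A : Set E} {f : E → ℝ} (hf : ConvexOn ℝ Set.univ f) (hc : Continuous f)
    (hh : ∀ (t : ℝ) (x : E), 0 ≤ t → f (t • x) = t * f x) (hA : ∀ a ∈ A, f a ≤ 1) (x : E) :
    (f x : EReal) ≤ atomicNorm A x := by
  refine le_atomicNorm_of_forall fun t ht hx => ?_
  obtain ⟨y, hy, rfl⟩ := hx
  have hsub : closure (convexHull ℝ A) ⊆ {y | f y ≤ 1} := by
    refine closure_minimal (convexHull_min hA ?_) (isClosed_le hc continuous_const)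
    simpa using hf.convex_le 1
  change f (t • y) ≤ t
  rw [hh t y ht]
  exact mul_le_of_le_one_right ht (hsub hy)

/-- Duality criterion for membership in a dilation of the closed convex hull. -/
theorem mem_smul_closure_convexHull [CompleteSpace E] {A : Set E} {w : E} {t : ℝ} (ht : 0 < t)
    (h : ∀ (y : E) (b : ℝ), (∀ a ∈ A, inner ℝ y a ≤ b) → inner ℝ y w ≤ t * b) :
    w ∈ t • closure (convexHull ℝ A) := by
  rw [Set.mem_smul_set_iff_inv_smul_mem₀ ht.ne']
  by_contra hw
  obtain ⟨f, u, hu, huw⟩ := geometric_hahn_banach_closed_point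
    ((convex_convexHull ℝ A).closure) isClosed_closure hw
  have hf : ∀ v, inner ℝ ((InnerProductSpace.toDual ℝ E).symm f) v = f v := fun v =>
    InnerProductSpace.toDual_symm_apply
  have := h ((InnerProductSpace.toDual ℝ E).symm f) u fun a ha => by
    rw [hf]; exact (hu a (subset_closure (subset_convexHull ℝ A ha))).le
  rw [hf] at this
  rw [map_smul, smul_eq_mul, lt_inv_mul_iff₀ ht] at huw
  linarith

theorem convexOn_norm_univ : ConvexOn ℝ Set.univ (fun x : E => ‖x‖) :=
  convexOn_norm convex_univ

/-- A positive lower bound `D` for the radicand replaces the model norm, which need not be computed,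
and keeps the denominator nonzero. -/
theorem suffRatio_le {S : Set E} {x z : E} {β D : ℝ} (hβ : 0 ≤ β) (hx : x ≠ 0) (hD : 0 < D)
    (hDle : D ≤ (modelNorm S (x + z)).toReal ^ 2 - ‖x‖ ^ 2 - 2 * inner ℝ x z)
    (h : -inner ℝ x z ≤ β * (‖x‖ * √D)) : suffRatio S x z ≤ β := by
  have hx' : 0 < ‖x‖ := norm_pos_iff.2 hx
  have hsD : 0 < √D := Real.sqrt_pos.2 hD
  have hs := Real.sqrt_le_sqrt hDle
  unfold suffRatio
  rw [div_le_iff₀ (mul_pos hx' (hsD.trans_le hs))]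
  exact h.trans (by gcongr)

theorem deltaSuff_le {S : Set E} {R : E → ℝ} {z : E} {β : ℝ} (hz : z ∈ descentCone R S)
    (hz0 : z ≠ 0) (h : ∀ x ∈ S, x ≠ 0 → suffRatio S x z ≤ β) : deltaSuff S R ≤ β :=
  (iInf₂_le z ⟨hz, hz0⟩).trans (iSup₂_le fun x hx => by exact_mod_cast h x hx.1 hx.2)

theorem le_deltaSuff {S : Set E} {R : E → ℝ} {β : ℝ}
    (h : ∀ z ∈ descentCone R S, z ≠ 0 → ∃ x ∈ S, x ≠ 0 ∧ β ≤ suffRatio S x z) :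
    β ≤ deltaSuff S R := by
  refine le_iInf₂ fun z hz => ?_
  obtain ⟨x, hx, hx0, hle⟩ := h z hz.1 hz.2
  exact le_iSup₂_of_le x ⟨hx, hx0⟩ (by exact_mod_cast hle)

/-- The difference of two model vectors lies in every symmetrized descent cone. -/
theorem sub_mem_descentCone (R : E → ℝ) {S : Set E} {x y : E} (hx : x ∈ S) (hy : y ∈ S) :
    x - y ∈ descentCone R S := by
  rcases le_total (R x) (R y) with h | h
  · exact Set.mem_biUnion hy ⟨1, x - y, by simpa using h, by simp⟩
  · exact Set.mem_biUnion hx ⟨-1, y - x, by simpa using h, by simp⟩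

theorem mem_descentCone {R : E → ℝ} {S : Set E} {x z : E} (hx : x ∈ S) (h : R (x + z) ≤ R x) :
    z ∈ descentCone R S :=
  Set.mem_biUnion hx ⟨1, z, h, by simp⟩

end Atomic

/-! ### The `ℓ¹`-norm as a regularizer. -/

section L1

variable {n : ℕ}

theorem l1Norm_nonneg (x : EuclideanSpace ℝ (Fin n)) : 0 ≤ l1Norm n x :=
  Finset.sum_nonneg fun _ _ => abs_nonneg _

theorem l1Norm_smul (t : ℝ) (x : EuclideanSpace ℝ (Fin n)) :
    l1Norm n (t • x) = |t| * l1Norm n x := by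
  simp [l1Norm, abs_mul, Finset.mul_sum]

theorem l1Norm_add_le (x y : EuclideanSpace ℝ (Fin n)) :
    l1Norm n (x + y) ≤ l1Norm n x + l1Norm n y := by
  rw [l1Norm, l1Norm, l1Norm, ← Finset.sum_add_distrib]
  exact Finset.sum_le_sum fun i _ => abs_add_le _ _

theorem l1Norm_single (i : Fin n) (a : ℝ) : l1Norm n (EuclideanSpace.single i a) = |a| := by
  rw [l1Norm, Finset.sum_eq_single i] <;> simp +contextual

theorem continuous_l1Norm : Continuous (l1Norm n) := by
  unfold l1Norm; fun_prop

theorem convexOn_l1Norm : ConvexOn ℝ Set.univ (l1Norm n) := by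
  refine ⟨convex_univ, fun x _ y _ a b ha hb _ => ?_⟩
  refine (l1Norm_add_le _ _).trans ?_
  rw [l1Norm_smul, l1Norm_smul, abs_of_nonneg ha, abs_of_nonneg hb]; rfl

theorem norm_le_l1Norm (x : EuclideanSpace ℝ (Fin n)) : ‖x‖ ≤ l1Norm n x := by
  refine abs_le_of_sq_le_sq' ?_ (l1Norm_nonneg x) |>.2
  rw [EuclideanSpace.real_norm_sq_eq, l1Norm]
  simpa using Finset.sum_sq_le_sq_sum_of_nonneg (s := Finset.univ)
    (f := fun i => |x i|) fun i _ => abs_nonneg _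

theorem smul_l1Norm_mem_coerciveConvex {c : ℝ} (hc : 0 < c) :
    (fun x => c * l1Norm n x) ∈ coerciveConvex (EuclideanSpace ℝ (Fin n)) := by
  refine ⟨convexOn_l1Norm.smul hc.le, continuous_const.mul continuous_l1Norm, ?_⟩
  exact (tendsto_atTop_mono norm_le_l1Norm tendsto_norm_cobounded_atTop).const_mul_atTop hc

theorem inner_eq_sum (x y : EuclideanSpace ℝ (Fin n)) : inner ℝ x y = ∑ i, x i * y i := by
  simp [PiLp.inner_apply, mul_comm]

end L1

/-! ### Sparse vectors and lower bounds for their model norm. -/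

section Sparse

variable {n k : ℕ}

theorem mem_sparseVectors_of_support_subset {x : EuclideanSpace ℝ (Fin n)} (T : Finset (Fin n))
    (hT : T.card ≤ k) (h : ∀ i ∉ T, x i = 0) : x ∈ sparseVectors n k := by
  have hsub : {i | x i ≠ 0} ⊆ (T : Set (Fin n)) := fun i hi => by
    by_contra hiT
    exact hi (h i hiT)
  have := Set.ncard_le_ncard hsub T.finite_toSet
  rw [Set.ncard_coe_finset] at this
  exact this.trans hT

theorem exists_support_of_mem_sparseVectors {x : EuclideanSpace ℝ (Fin n)}
    (hx : x ∈ sparseVectors n k) : ∃ T : Finset (Fin n), T.card ≤ k ∧ ∀ i ∉ T, x i = 0 := by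
  classical
  refine ⟨Finset.univ.filter fun i => x i ≠ 0, ?_, fun i hi => by simpa using hi⟩
  have : ({i | x i ≠ 0} : Set (Fin n)).ncard ≤ k := hx
  rwa [Set.ncard_eq_toFinset_card', Set.toFinset_ofPred] at this

theorem single_mem_sparseVectors (hk : 1 ≤ k) (i : Fin n) (a : ℝ) :
    EuclideanSpace.single i a ∈ sparseVectors n k :=
  mem_sparseVectors_of_support_subset {i} (by simpa) fun j hj => by
    simp at hj; simp [hj]

theorem exists_eq_single_of_mem_sparseVectors_one (hn : 1 ≤ n) {x : EuclideanSpace ℝ (Fin n)}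
    (hx : x ∈ sparseVectors n 1) : ∃ i a, x = EuclideanSpace.single i a := by
  obtain ⟨T, hT, h⟩ := exists_support_of_mem_sparseVectors hx
  obtain ⟨i, hi⟩ : ∃ i, T ⊆ {i} := by
    have : Nonempty (Fin n) := ⟨⟨0, hn⟩⟩
    exact Finset.card_le_one_iff_subset_singleton.1 hT
  refine ⟨i, x i, ?_⟩
  ext j
  by_cases hj : j = i
  · subst hj; simp
  · simp [hj, h j fun hjT => hj (by simpa using hi hjT)]

/-- The finite index set of the `k` largest values of a function. -/
theorem exists_card_eq_forall_le {ι : Type*} [Fintype ι] (f : ι → ℝ) (hk : k ≤ Fintype.card ι) :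
    ∃ T : Finset ι, T.card = k ∧ ∀ i ∈ T, ∀ j ∉ T, f j ≤ f i := by
  classical
  induction k with
  | zero => exact ⟨∅, by simp⟩
  | succ k ih =>
    obtain ⟨T, hT, h⟩ := ih (by omega)
    have hne : (Finset.univ \ T).Nonempty := by
      rw [← Finset.card_pos, Finset.card_sdiff_of_subset (Finset.subset_univ _), Finset.card_univ]
      omega
    obtain ⟨m, hm, hmax⟩ := Finset.exists_max_image _ f hne
    simp only [Finset.mem_sdiff, Finset.mem_univ, true_and] at hm hmax
    refine ⟨insert m T, by rw [Finset.card_insert_of_notMem hm, hT], ?_⟩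
    intro i hi j hj
    simp only [Finset.mem_insert, not_or] at hi hj
    rcases hi with rfl | hi
    · exact hmax j hj.2
    · exact h i hi j hj.2

theorem le_modelNorm_toReal (hk : 1 ≤ k) (hn : 1 ≤ n) {f : EuclideanSpace ℝ (Fin n) → ℝ}
    (hf : ConvexOn ℝ Set.univ f) (hc : Continuous f)
    (hh : ∀ (t : ℝ) (x), 0 ≤ t → f (t • x) = t * f x)
    (hS : ∀ a ∈ sparseVectors n k, ‖a‖ = 1 → f a ≤ 1) (x : EuclideanSpace ℝ (Fin n)) :
    f x ≤ (modelNorm (sparseVectors n k) x).toReal := by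
  have hne := modelNorm_sparseVectors_ne_top hk hn x
  rw [← EReal.coe_le_coe_iff, EReal.coe_toReal hne.1 hne.2]
  exact le_atomicNorm hf hc hh (fun a ha => hS a ha.1 (by simpa using ha.2)) x

theorem norm_le_modelNorm_toReal (hk : 1 ≤ k) (hn : 1 ≤ n) (x : EuclideanSpace ℝ (Fin n)) :
    ‖x‖ ≤ (modelNorm (sparseVectors n k) x).toReal :=
  le_modelNorm_toReal hk hn convexOn_norm_univ continuous_norm
    (fun t x ht => by rw [norm_smul, Real.norm_of_nonneg ht]) (fun a _ ha => ha.le) x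

theorem l1Norm_le_modelNorm_toReal (hn : 1 ≤ n) (x : EuclideanSpace ℝ (Fin n)) :
    l1Norm n x ≤ (modelNorm (sparseVectors n 1) x).toReal := by
  refine le_modelNorm_toReal le_rfl hn convexOn_l1Norm continuous_l1Norm
    (fun t x ht => by rw [l1Norm_smul, abs_of_nonneg ht]) (fun a ha ha1 => ?_) x
  obtain ⟨i, b, rfl⟩ := exists_eq_single_of_mem_sparseVectors_one hn ha
  rw [l1Norm_single]
  simpa using ha1.le

end Sparse

/-! ### The value `1/√2` for general `k`. -/

section Truncate

variable {n k : ℕ}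

/-- The restriction of a vector to a set of coordinates. -/
def truncate (T : Finset (Fin n)) (x : EuclideanSpace ℝ (Fin n)) : EuclideanSpace ℝ (Fin n) :=
  WithLp.toLp 2 fun i => if i ∈ T then x i else 0

@[simp] theorem truncate_apply (T : Finset (Fin n)) (x : EuclideanSpace ℝ (Fin n)) (i : Fin n) :
    truncate T x i = if i ∈ T then x i else 0 := rfl

theorem inner_truncate (T : Finset (Fin n)) (x y : EuclideanSpace ℝ (Fin n)) :
    inner ℝ (truncate T x) y = ∑ i ∈ T, x i * y i := by
  simp [inner_eq_sum, Finset.sum_ite_mem]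

theorem norm_truncate_sq (T : Finset (Fin n)) (x : EuclideanSpace ℝ (Fin n)) :
    ‖truncate T x‖ ^ 2 = ∑ i ∈ T, x i ^ 2 := by
  rw [← real_inner_self_eq_norm_sq, inner_truncate]
  exact Finset.sum_congr rfl fun i hi => by simp [hi, sq]

theorem truncate_mem_sparseVectors {T : Finset (Fin n)} (hT : T.card ≤ k)
    (x : EuclideanSpace ℝ (Fin n)) : truncate T x ∈ sparseVectors n k :=
  mem_sparseVectors_of_support_subset T hT fun i hi => by simp [hi]

/-- A weighted sum with weights at most `m` and total weight at most `k * m` is at most `m` times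
the sum of the `k` largest values. -/
theorem sum_mul_le_of_forall_le {ι : Type*} [Fintype ι] {f c : ι → ℝ} {m : ℝ} {T : Finset ι}
    (hk : 1 ≤ k) (hT : T.card = k) (hf : ∀ i, 0 ≤ f i) (h : ∀ i ∈ T, ∀ j ∉ T, f j ≤ f i)
    (hc : ∀ i, 0 ≤ c i) (hcm : ∀ i, c i ≤ m) (hsum : ∑ i, c i ≤ k * m) :
    ∑ i, c i * f i ≤ m * ∑ i ∈ T, f i := by
  classical
  -- The smallest value on `T` is a threshold: values off `T` lie below it, and on `T` only the
  -- excess over it needs weight `m`.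
  obtain ⟨i₀, hi₀, hmin⟩ := Finset.exists_min_image T f (Finset.card_pos.1 (by omega))
  have hpt : ∀ i, c i * f i ≤ c i * f i₀ + if i ∈ T then m * (f i - f i₀) else 0 := by
    intro i
    split_ifs with hi
    · nlinarith [hmin i hi, hcm i]
    · simpa using mul_le_mul_of_nonneg_left (h i₀ hi₀ i hi) (hc i)
  calc ∑ i, c i * f i ≤ ∑ i, (c i * f i₀ + if i ∈ T then m * (f i - f i₀) else 0) :=
        Finset.sum_le_sum fun i _ => hpt i
    _ = (∑ i, c i) * f i₀ + m * ∑ i ∈ T, f i - k * m * f i₀ := by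
        rw [Finset.sum_add_distrib, ← Finset.sum_mul, Finset.sum_ite_mem, Finset.univ_inter,
          ← Finset.mul_sum, Finset.sum_sub_distrib, Finset.sum_const, hT, nsmul_eq_mul]
        ring
    _ ≤ m * ∑ i ∈ T, f i := by nlinarith [hf i₀]

/-- A vector with entries at most `m` and `ℓ¹`-norm at most `k * m` has model norm at most
`m * √k`. -/
theorem modelNorm_toReal_le (hk : 1 ≤ k) (hkn : k ≤ n) {m : ℝ} (hm : 0 < m)
    {w : EuclideanSpace ℝ (Fin n)} (hwm : ∀ i, |w i| ≤ m) (hw : l1Norm n w ≤ k * m) :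
    (modelNorm (sparseVectors n k) w).toReal ≤ m * √k := by
  have hk0 : (0 : ℝ) < k := by exact_mod_cast hk
  have ht : 0 < m * √k := mul_pos hm (Real.sqrt_pos.2 hk0)
  have hne := modelNorm_sparseVectors_ne_top hk (hk.trans hkn) w
  rw [← EReal.coe_le_coe_iff, EReal.coe_toReal hne.1 hne.2]
  refine atomicNorm_le ht.le (mem_smul_closure_convexHull ht fun y b hy => ?_)
  obtain ⟨U, hU, htop⟩ := exists_card_eq_forall_le (fun i => |y i|) (by simpa using hkn)
  have hle := sum_mul_le_of_forall_le (c := fun i => |w i|) hk hU (fun i => abs_nonneg _) htop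
    (fun i => abs_nonneg _) hwm hw
  -- After normalization, `g` is the unit `k`-sparse vector maximizing the pairing with `y`: equal
  -- magnitudes are enough because the entries of `w` are at most `m`.
  set g : EuclideanSpace ℝ (Fin n) :=
    truncate U (WithLp.toLp 2 fun i => m * if 0 ≤ y i then 1 else -1) with hg
  have hgnorm : ‖g‖ = m * √k := by
    refine (pow_left_inj₀ (norm_nonneg _) ht.le two_ne_zero).1 ?_
    rw [hg, norm_truncate_sq, mul_pow, Real.sq_sqrt hk0.le, Finset.sum_congr rfl
      (g := fun _ => m ^ 2) fun i _ => by dsimp only; split_ifs <;> ring,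
      Finset.sum_const, hU, nsmul_eq_mul, mul_comm]
  have hgy : inner ℝ y g = m * ∑ i ∈ U, |y i| := by
    rw [real_inner_comm, hg, inner_truncate, Finset.mul_sum]
    refine Finset.sum_congr rfl fun i _ => ?_
    dsimp only
    split_ifs with h
    · rw [abs_of_nonneg h]; ring
    · rw [abs_of_neg (not_le.1 h)]; ring
  have hb := hy (‖g‖⁻¹ • g) ⟨?_, ?_⟩
  · rw [inner_smul_right, hgy, hgnorm, inv_mul_le_iff₀ ht] at hb
    refine le_trans ?_ (hle.trans hb)
    rw [inner_eq_sum]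
    exact Finset.sum_le_sum fun i _ => by
      rw [mul_comm, ← abs_mul]; exact le_abs_self _
  · exact mem_sparseVectors_of_support_subset U hU.le fun i hi => by simp [hg, hi]
  · rw [mem_sphere_zero_iff_norm, norm_smul, norm_inv, norm_norm,
      inv_mul_cancel₀ (hgnorm ▸ ht.ne')]

/-- Vectors in the symmetrized descent cone of the `ℓ¹`-norm concentrate half of their `ℓ¹`-norm
on their `k` largest entries. -/
theorem l1Norm_le_of_mem_descentCone (hk : 1 ≤ k) {z : EuclideanSpace ℝ (Fin n)}
    (hz : z ∈ descentCone (l1Norm n) (sparseVectors n k)) {T : Finset (Fin n)} (hT : T.card = k)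
    (h : ∀ i ∈ T, ∀ j ∉ T, |z j| ≤ |z i|) : l1Norm n z ≤ 2 * ∑ i ∈ T, |z i| := by
  classical
  obtain ⟨x, hx, γ, v, hle, rfl⟩ := Set.mem_iUnion₂.1 hz
  obtain ⟨S, hS, hxS⟩ := exists_support_of_mem_sparseVectors hx
  have hv : l1Norm n v ≤ 2 * ∑ i ∈ S, |v i| := by
    -- Equality off `S`, where `x` vanishes; on `S` it is the triangle inequality. Summing and
    -- cancelling with the descent inequality bounds the `ℓ¹`-norm of `v`.
    have hpt : ∀ i, |x i| + |v i| ≤ |x i + v i| + if i ∈ S then 2 * |v i| else 0 := by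
      intro i
      split_ifs with hi
      · have := abs_sub (x i + v i) (v i)
        rw [add_sub_cancel_right] at this
        linarith
      · simp [hxS i hi]
    have := Finset.sum_le_sum fun i (_ : i ∈ Finset.univ) => hpt i
    rw [Finset.sum_add_distrib, Finset.sum_add_distrib, Finset.sum_ite_mem, Finset.univ_inter,
      ← Finset.mul_sum] at this
    have hle' : ∑ i, |x i + v i| ≤ ∑ i, |x i| := hle
    rw [l1Norm]
    linarith
  -- Indicator weights of `S` show that `T` carries at least as much mass as the support of `x`.
  have hsum := sum_mul_le_of_forall_le (f := fun i => |(γ • v) i|)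
    (c := fun i => if i ∈ S then 1 else 0) (m := 1) hk hT (fun i => abs_nonneg _) h
    (fun i => by split_ifs <;> simp) (fun i => by split_ifs <;> simp)
    (by simpa [Finset.sum_ite_mem] using hS)
  simp only [ite_mul, one_mul, zero_mul, Finset.sum_ite_mem, Finset.univ_inter] at hsum
  rw [l1Norm_smul]
  have : ∑ i ∈ S, |(γ • v) i| = |γ| * ∑ i ∈ S, |v i| := by simp [abs_mul, Finset.mul_sum]
  nlinarith [abs_nonneg γ]

theorem le_deltaSuff_l1Norm (hk : 1 ≤ k) (hkn : k ≤ n) :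
    ((1 / √2 : ℝ) : EReal) ≤ deltaSuff (sparseVectors n k) (l1Norm n) := by
  classical
  refine le_deltaSuff fun z hz hz0 => ?_
  have hk0 : (0 : ℝ) < k := by exact_mod_cast hk
  obtain ⟨T, hT, htop⟩ := exists_card_eq_forall_le (fun i => |z i|) (by simpa using hkn)
  have hl1 := l1Norm_le_of_mem_descentCone hk hz hT htop
  set s := ∑ i ∈ T, |z i| with hs
  have hspos : 0 < s := by
    have := (norm_pos_iff.2 hz0).trans_le (norm_le_l1Norm z)
    linarith
  have hq : ‖truncate T z‖ ^ 2 = ∑ i ∈ T, z i ^ 2 := norm_truncate_sq T z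
  have hsq : s ^ 2 ≤ k * ‖truncate T z‖ ^ 2 := by
    have := sq_sum_le_card_mul_sum_sq (s := T) (f := fun i => |z i|)
    simpa [hT, hq] using this
  have hqpos : 0 < ‖truncate T z‖ := by
    by_contra hneg
    have : ‖truncate T z‖ = 0 := le_antisymm (not_lt.1 hneg) (norm_nonneg _)
    rw [this] at hsq
    nlinarith
  have hw : (modelNorm (sparseVectors n k) (-truncate T z + z)).toReal ≤ s / k * √k := by
    have hwi : ∀ i, (-truncate T z + z) i = if i ∈ T then 0 else z i := fun i => by
      by_cases hi : i ∈ T <;> simp [hi]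
    refine modelNorm_toReal_le hk hkn (by positivity) (fun i => ?_) ?_
    · rw [hwi]
      split_ifs with hi
      · rw [abs_zero]; positivity
      -- An entry off `T` is below each of the `k` entries on `T`, hence below their average `s /
      -- k`.
      · rw [le_div_iff₀ hk0, mul_comm, ← hT, ← nsmul_eq_mul]
        exact Finset.card_nsmul_le_sum _ _ _ fun j hj => htop j hj i hi
    · rw [mul_div_cancel₀ _ hk0.ne']
      have hsplit : l1Norm n (-truncate T z + z) + s = l1Norm n z := by
        have hs' : s = ∑ i, if i ∈ T then |z i| else 0 := by
          rw [Finset.sum_ite_mem, Finset.univ_inter]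
        rw [l1Norm, l1Norm, hs', ← Finset.sum_add_distrib]
        refine Finset.sum_congr rfl fun i _ => ?_
        rw [hwi]
        by_cases hi : i ∈ T <;> simp [hi]
      linarith
  have hM0 : 0 ≤ (modelNorm (sparseVectors n k) (-truncate T z + z)).toReal :=
    (norm_nonneg _).trans (norm_le_modelNorm_toReal hk (hk.trans hkn) _)
  have hM : (modelNorm (sparseVectors n k) (-truncate T z + z)).toReal ^ 2 ≤
      ‖truncate T z‖ ^ 2 := by
    refine (pow_le_pow_left₀ hM0 hw 2).trans ?_
    rw [mul_pow, Real.sq_sqrt hk0.le, div_pow]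
    rw [show s ^ 2 / (k : ℝ) ^ 2 * k = s ^ 2 / k by field_simp, div_le_iff₀ hk0]
    linarith
  have hinner : inner ℝ (truncate T z) z = ‖truncate T z‖ ^ 2 := by
    rw [inner_truncate, hq]; exact Finset.sum_congr rfl fun i _ => (sq _).symm
  refine ⟨-truncate T z, ?_, neg_ne_zero.2 (norm_pos_iff.1 hqpos), ?_⟩
  · exact mem_sparseVectors_of_support_subset T hT.le fun i hi => by simp [hi]
  set M := (modelNorm (sparseVectors n k) (-truncate T z + z)).toReal
  set q := ‖truncate T z‖
  unfold suffRatio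
  rw [norm_neg, inner_neg_left, hinner]
  change _ ≤ _ / (q * √(M ^ 2 - q ^ 2 - 2 * -q ^ 2))
  have hr : √(M ^ 2 - q ^ 2 - 2 * -q ^ 2) ≤ √2 * q := by
    refine Real.sqrt_le_iff.2 ⟨by positivity, ?_⟩
    rw [mul_pow, Real.sq_sqrt zero_le_two]; linarith
  have hr0 : 0 < √(M ^ 2 - q ^ 2 - 2 * -q ^ 2) := Real.sqrt_pos.2 (by nlinarith)
  rw [div_le_div_iff₀ (by positivity) (mul_pos hqpos hr0), one_mul, neg_neg]
  nlinarith

/-- No regularizer whatsoever has a sufficient constant exceeding `1 / √2`. -/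
theorem deltaSuff_sparseVectors_le (hk : 1 ≤ k) (hkn : 2 * k ≤ n)
    (R : EuclideanSpace ℝ (Fin n) → ℝ) :
    deltaSuff (sparseVectors n k) R ≤ ((1 / √2 : ℝ) : EReal) := by
  classical
  have hk0 : (0 : ℝ) < k := by exact_mod_cast hk
  obtain ⟨T, -, hT⟩ := Finset.exists_subset_card_eq
    (s := (Finset.univ : Finset (Fin n))) (n := k) (by simp; omega)
  obtain ⟨U, hUT, hU⟩ := Finset.exists_subset_card_eq
    (s := (Finset.univ \ T : Finset (Fin n))) (n := k) (by
      rw [Finset.card_sdiff_of_subset (Finset.subset_univ _), Finset.card_univ, Fintype.card_fin]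
      omega)
  have hdisj : ∀ i ∈ T, i ∉ U := fun i hi hiU => (Finset.mem_sdiff.1 (hUT hiU)).2 hi
  set o : EuclideanSpace ℝ (Fin n) := WithLp.toLp 2 fun _ => 1
  set z := truncate T o - truncate U o with hz
  have hznorm : ‖z‖ ^ 2 = 2 * k := by
    have horth : inner ℝ (truncate T o) (truncate U o) = 0 := by
      rw [inner_truncate]
      exact Finset.sum_eq_zero fun i hi => by simp [hdisj i hi]
    rw [hz, norm_sub_sq_real, norm_truncate_sq, norm_truncate_sq, horth]
    simp [o, hT, hU]; ring
  have hzi : ∀ i, z i ^ 2 ≤ 1 := fun i => by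
    by_cases hi : i ∈ T
    · simp [hz, hi, hdisj i hi, o]
    · by_cases hi' : i ∈ U <;> simp [hz, hi, hi', o]
  have hz0 : z ≠ 0 := by
    rintro h
    rw [h] at hznorm
    simp at hznorm; omega
  refine deltaSuff_le (sub_mem_descentCone R (truncate_mem_sparseVectors hT.le o)
    (truncate_mem_sparseVectors hU.le o)) hz0 fun x hx hx0 => ?_
  -- Replacing the model norm by the Euclidean norm turns the radicand into exactly `‖z‖²`.
  refine suffRatio_le (D := ‖z‖ ^ 2) (by positivity) hx0 (by positivity) ?_ ?_
  · have := pow_le_pow_left₀ (norm_nonneg _)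
      (norm_le_modelNorm_toReal hk (by omega) (x + z)) 2
    rw [norm_add_sq_real] at this
    linarith
  · obtain ⟨S, hS, hxS⟩ := exists_support_of_mem_sparseVectors hx
    have hin : inner ℝ x z = inner ℝ x (truncate S z) := by
      rw [real_inner_comm, real_inner_comm (truncate S z), inner_truncate, inner_eq_sum]
      refine (Finset.sum_subset (Finset.subset_univ S) fun i _ hi => ?_).symm
      simp [hxS i hi]
    have hSz : ‖truncate S z‖ ≤ √k := by
      refine Real.le_sqrt_of_sq_le ?_
      rw [norm_truncate_sq]
      refine (Finset.sum_le_card_nsmul S _ 1 fun i _ => hzi i).trans ?_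
      simpa using hS
    rw [hin, hznorm, Real.sqrt_mul zero_le_two]
    calc -inner ℝ x (truncate S z) ≤ ‖x‖ * ‖truncate S z‖ :=
          (neg_le_abs _).trans (abs_real_inner_le_norm _ _)
      _ ≤ ‖x‖ * √k := by gcongr
      _ = 1 / √2 * (‖x‖ * (√2 * √k)) := by field_simp

end Truncate

/-! ### Uniqueness of the maximizer for `k = 1`. -/

section OneSparse

variable {n k : ℕ}

theorem descentCone_const_mul {E : Type*} [NormedAddCommGroup E] [InnerProductSpace ℝ E]
    {c : ℝ} (hc : 0 < c) (R : E → ℝ) (S : Set E) :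
    descentCone (fun x => c * R x) S = descentCone R S := by
  simp only [descentCone, descentConeAt, mul_le_mul_iff_right₀ hc]

theorem deltaSuff_const_mul {E : Type*} [NormedAddCommGroup E] [InnerProductSpace ℝ E]
    {c : ℝ} (hc : 0 < c) (R : E → ℝ) (S : Set E) :
    deltaSuff S (fun x => c * R x) = deltaSuff S R := by
  rw [deltaSuff, deltaSuff, descentCone_const_mul hc]

theorem const_mul_l1Norm_mem_coerciveAtomic (hk : 1 ≤ k) {c : ℝ} (hc : 0 < c) :
    (fun x => c * l1Norm n x) ∈ coerciveAtomic (sparseVectors n k) := by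
  have hh : ∀ (t : ℝ) (x : EuclideanSpace ℝ (Fin n)), 0 ≤ t →
      c * l1Norm n (t • x) = t * (c * l1Norm n x) := fun t x ht => by
    rw [l1Norm_smul, abs_of_nonneg ht]; ring
  refine ⟨smul_l1Norm_mem_coerciveConvex hc, hh,
    {a | a ∈ sparseVectors n k ∧ c * l1Norm n a ≤ 1}, fun a ha => ha.1, fun x => ?_⟩
  have hcoe := smul_l1Norm_mem_coerciveConvex (n := n) hc
  refine le_antisymm (le_atomicNorm hcoe.1 hcoe.2.1 hh (fun a ha => ha.2) x) ?_
  refine atomicNorm_le (mul_nonneg hc.le (l1Norm_nonneg x)) ?_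
  change x ∈ (c * l1Norm n x) • _
  -- The duality criterion needs a positive dilation factor, so the origin is separate. Otherwise,
  -- testing on the atoms `±e_i / c` bounds each `|y i|` by `c * b`.
  rcases eq_or_ne x 0 with rfl | hx
  · have h0 : l1Norm n 0 = 0 := by simp [l1Norm]
    rw [h0, mul_zero]
    refine ⟨0, subset_closure (subset_convexHull ℝ _ ⟨?_, by simp [h0]⟩), by simp⟩
    exact mem_sparseVectors_of_support_subset ∅ (by simp) (by simp)
  · have hpos := (norm_pos_iff.2 hx).trans_le (norm_le_l1Norm x)
    refine mem_smul_closure_convexHull (mul_pos hc hpos) fun y b hy => ?_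
    have hyb : ∀ i, |y i| ≤ c * b := fun i => by
      have hmem : ∀ s : ℝ, |s| = 1 → s * y i ≤ c * b := fun s hs => by
        have := hy (EuclideanSpace.single i (s / c)) ⟨single_mem_sparseVectors hk i _, by
          rw [l1Norm_single, abs_div, hs, abs_of_pos hc, mul_one_div_cancel hc.ne']⟩
        rw [EuclideanSpace.inner_single_right, mul_comm] at this
        have h2 := mul_le_mul_of_nonneg_left this hc.le
        simp only [conj_trivial] at h2
        calc s * y i = c * (y i * (s / c)) := by field_simp
          _ ≤ c * b := by linarith
      exact abs_le'.2 ⟨by simpa using hmem 1 (by simp), by simpa using hmem (-1) (by simp)⟩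
    rw [inner_eq_sum]
    calc ∑ i, y i * x i ≤ ∑ i, c * b * |x i| := Finset.sum_le_sum fun i _ => by
          refine (le_abs_self _).trans ?_
          rw [abs_mul]
          exact mul_le_mul_of_nonneg_right (hyb i) (abs_nonneg _)
      _ = c * ∑ i, |x i| * b := by rw [Finset.mul_sum]; exact Finset.sum_congr rfl fun i _ => by ring
      _ = c * (∑ i, |x i|) * b := by rw [← Finset.sum_mul, mul_assoc]

/-- If no entry of a descent vector dominates, then the sufficient constant for the model of
`1`-sparse vectors is less than `1 / √2`. -/
theorem deltaSuff_lt_of_forall_abs_le (hn : 1 ≤ n) {R : EuclideanSpace ℝ (Fin n) → ℝ}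
    {z : EuclideanSpace ℝ (Fin n)} (hz : z ∈ descentCone R (sparseVectors n 1)) {ε : ℝ}
    (hε : 0 < ε) (hz0 : z ≠ 0) (h : ∀ i, (2 + ε) * |z i| ≤ l1Norm n z) :
    deltaSuff (sparseVectors n 1) R < ((1 / √2 : ℝ) : EReal) := by
  have hβ : 1 / √(1 + (1 + ε) ^ 2) < 1 / √2 :=
    one_div_lt_one_div_of_lt (by positivity) (Real.sqrt_lt_sqrt zero_le_two (by nlinarith))
  refine lt_of_le_of_lt (deltaSuff_le hz hz0 fun x hx hx0 => ?_) (EReal.coe_lt_coe_iff.2 hβ)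
  obtain ⟨m, a, rfl⟩ := exists_eq_single_of_mem_sparseVectors_one hn hx
  have hl1 := (norm_pos_iff.2 hz0).trans_le (norm_le_l1Norm z)
  set r := l1Norm n z - |z m| with hr
  have hr1 : (1 + ε) * |z m| ≤ r := by linarith [h m]
  have hr0 : 0 < r := by nlinarith [h m, abs_nonneg (z m)]
  have hnorm : ‖EuclideanSpace.single m a‖ = |a| := by simp
  have hinner : inner ℝ (EuclideanSpace.single m a) z = a * z m := by
    rw [EuclideanSpace.inner_single_left]; simp
  have hadd : l1Norm n (EuclideanSpace.single m a + z) = |a + z m| + r := by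
    rw [hr, l1Norm, l1Norm, ← Finset.add_sum_erase _ _ (Finset.mem_univ m),
      ← Finset.add_sum_erase _ (fun i => |z i|) (Finset.mem_univ m), add_sub_cancel_left]
    congr 1
    · simp
    · exact Finset.sum_congr rfl fun i hi => by simp [Finset.ne_of_mem_erase hi]
  -- Expanding `(|a + z m| + r)²` and dropping the nonnegative cross term leaves this `D`,
  -- independent of `a`. Non-dominance then gives `D ≥ (1 + (1 + ε)²) (z m)²`.
  refine suffRatio_le (D := z m ^ 2 + r ^ 2) (by positivity) hx0 (by positivity) ?_ ?_
  · have := pow_le_pow_left₀ (l1Norm_nonneg _)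
      (l1Norm_le_modelNorm_toReal hn (EuclideanSpace.single m a + z)) 2
    rw [hadd] at this
    rw [hnorm, hinner, sq_abs]
    nlinarith [sq_abs (a + z m), mul_nonneg (abs_nonneg (a + z m)) hr0.le]
  · rw [hnorm, hinner, one_div_mul_eq_div, le_div_iff₀ (by positivity)]
    refine (mul_le_mul_of_nonneg_right (neg_le_abs _) (Real.sqrt_nonneg _)).trans ?_
    rw [abs_mul, mul_assoc]
    refine mul_le_mul_of_nonneg_left (Real.le_sqrt_of_sq_le ?_) (abs_nonneg a)
    rw [mul_pow, sq_abs, Real.sq_sqrt (by positivity)]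
    have := pow_le_pow_left₀ (by positivity) hr1 2
    rw [mul_pow, sq_abs] at this
    linarith

theorem add_le_of_convexOn_of_homogeneous {E : Type*} [AddCommGroup E] [Module ℝ E] {R : E → ℝ}
    (hR : ConvexOn ℝ Set.univ R) (hh : ∀ (t : ℝ) (x : E), 0 ≤ t → R (t • x) = t * R x) (x y : E) :
    R (x + y) ≤ R x + R y := by
  have h := hR.2 (Set.mem_univ ((2 : ℝ) • x)) (Set.mem_univ ((2 : ℝ) • y))
    (show (0 : ℝ) ≤ 1 / 2 by norm_num) (show (0 : ℝ) ≤ 1 / 2 by norm_num) (by norm_num)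
  simp only [smul_smul, smul_eq_mul, hh 2 _ zero_le_two] at h
  norm_num at h
  linarith

/-- An optimal sublinear regularizer for `1`-sparse vectors does not distinguish signed unit
vectors of different coordinates. -/
theorem apply_single_le_of_le_deltaSuff (hn : 2 < n) {R : EuclideanSpace ℝ (Fin n) → ℝ}
    (hR : ConvexOn ℝ Set.univ R)
    (hh : ∀ (t : ℝ) (x : EuclideanSpace ℝ (Fin n)), 0 ≤ t → R (t • x) = t * R x)
    (hδ : ((1 / √2 : ℝ) : EReal) ≤ deltaSuff (sparseVectors n 1) R) {i j : Fin n} (hij : i ≠ j)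
    {s s' : ℝ} (hs : |s| = 1) (hs' : |s'| = 1) :
    R (EuclideanSpace.single i s) ≤ R (EuclideanSpace.single j s') := by
  by_contra! hlt
  obtain ⟨l, hli, hlj⟩ : ∃ l : Fin n, l ≠ i ∧ l ≠ j := by
    obtain ⟨l, -, hl⟩ := Finset.exists_mem_notMem_of_card_lt_card
      (s := {i, j}) (t := (Finset.univ : Finset (Fin n)))
      (Finset.card_le_two.trans_lt (by simpa using hn))
    simp only [Finset.mem_insert, Finset.mem_singleton, not_or] at hl
    exact ⟨l, hl⟩
  -- The strict gap absorbs a small multiple of `e_l`; `ε ≤ 1` keeps all entries of the descent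
  -- vector at most `1` while its `ℓ¹`-norm is `2 + ε`.
  obtain ⟨ε, hε, hε1, hεR⟩ : ∃ ε : ℝ, 0 < ε ∧ ε ≤ 1 ∧ R (EuclideanSpace.single j s') +
      ε * R (EuclideanSpace.single l 1) ≤ R (EuclideanSpace.single i s) := by
    set d := R (EuclideanSpace.single i s) - R (EuclideanSpace.single j s') with hd
    have hd0 : 0 < d := sub_pos.2 hlt
    set M := |R (EuclideanSpace.single l 1)|
    have hM : 0 ≤ M := abs_nonneg _
    refine ⟨d / (d + M), by positivity, div_le_one_of_le₀ (by linarith) (by positivity), ?_⟩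
    have h1 : d / (d + M) * R (EuclideanSpace.single l 1) ≤ d / (d + M) * M :=
      mul_le_mul_of_nonneg_left (le_abs_self _) (by positivity)
    have h2 : d / (d + M) * M ≤ d := by
      rw [div_mul_eq_mul_div, div_le_iff₀ (by positivity)]; nlinarith
    linarith
  set w : EuclideanSpace ℝ (Fin n) :=
    EuclideanSpace.single j s' + ε • EuclideanSpace.single l 1 with hw
  have hz : -EuclideanSpace.single i s + w ∈ descentCone R (sparseVectors n 1) := by
    refine mem_descentCone (single_mem_sparseVectors le_rfl i s) ?_
    rw [add_neg_cancel_left, hw]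
    refine (add_le_of_convexOn_of_homogeneous hR hh _ _).trans ?_
    rwa [hh ε _ hε.le]
  have hzval : ∀ m, |(-EuclideanSpace.single i s + w) m| =
      (if m = i then 1 else 0) + (if m = j then 1 else 0) + if m = l then ε else 0 := by
    intro m
    by_cases hmi : m = i
    · subst hmi; simp [hw, hij, hli.symm, hs]
    · by_cases hmj : m = j
      · subst hmj; simp [hw, hmi, hlj.symm, hs']
      · by_cases hml : m = l
        · subst hml; simp [hw, hmi, hmj, abs_of_pos hε]
        · simp [hw, hmi, hmj, hml]
  have hzl1 : l1Norm n (-EuclideanSpace.single i s + w) = 2 + ε := by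
    rw [l1Norm, Finset.sum_congr rfl fun m _ => hzval m]
    simp [Finset.sum_add_distrib]; norm_num
  refine absurd hδ (not_le.2 (deltaSuff_lt_of_forall_abs_le (by omega) hz hε ?_ fun m => ?_))
  · intro h
    have := hzl1
    rw [h] at this
    simp [l1Norm] at this
    linarith
  · rw [hzl1, hzval]
    have : (if m = i then (1 : ℝ) else 0) + (if m = j then 1 else 0) + (if m = l then ε else 0)
        ≤ 1 := by
      by_cases hmi : m = i
      · subst hmi; simp [hij, hli.symm]
      · by_cases hmj : m = j
        · subst hmj; simp [hmi, hlj.symm]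
        · by_cases hml : m = l
          · subst hml; simpa [hmi, hmj] using hε1
          · simp [hmi, hmj, hml]
    nlinarith

theorem eq_const_mul_l1Norm_of_le_deltaSuff (hn : 2 < n) {R : EuclideanSpace ℝ (Fin n) → ℝ}
    (hR : R ∈ coerciveAtomic (sparseVectors n 1))
    (hδ : ((1 / √2 : ℝ) : EReal) ≤ deltaSuff (sparseVectors n 1) R) :
    ∃ c : ℝ, 0 < c ∧ R = fun x => c * l1Norm n x := by
  obtain ⟨⟨hconv, -, hcoe⟩, hh, A, hA, hRA⟩ := hR
  set i₀ : Fin n := ⟨0, by omega⟩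
  set i₁ : Fin n := ⟨1, by omega⟩
  have h01 : i₀ ≠ i₁ := by simp [i₀, i₁]
  set c := R (EuclideanSpace.single i₀ 1) with hc
  have key : ∀ {i j : Fin n} (_ : i ≠ j) {s s' : ℝ} (_ : |s| = 1) (_ : |s'| = 1),
      R (EuclideanSpace.single i s) = R (EuclideanSpace.single j s') :=
    fun hij _ _ hs hs' => le_antisymm (apply_single_le_of_le_deltaSuff hn hconv hh hδ hij hs hs')
      (apply_single_le_of_le_deltaSuff hn hconv hh hδ hij.symm hs' hs)
  have hunit : ∀ (i : Fin n) (s : ℝ), |s| = 1 → R (EuclideanSpace.single i s) = c := by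
    intro i s hs
    rcases eq_or_ne i i₀ with rfl | hi
    -- `key` compares only distinct coordinates, so a sign change at `i₀` passes through `i₁`.
    · exact (key h01 hs (s' := 1) (by simp)).trans (key h01.symm (by simp) (by simp))
    · exact key hi hs (by simp)
  have hsingle : ∀ (i : Fin n) (a : ℝ), R (EuclideanSpace.single i a) = |a| * c := by
    intro i a
    rcases le_total 0 a with ha | ha
    · rw [← hunit i 1 (by simp), ← hh _ _ (abs_nonneg a), abs_of_nonneg ha]
      congr 1; ext j; simp
    · rw [← hunit i (-1) (by simp), ← hh _ _ (abs_nonneg a), abs_of_nonpos ha]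
      congr 1; ext j; by_cases hj : j = i <;> simp [hj]
  have hcpos : 0 < c := by
    -- Coercivity along one coordinate axis forces `c > 0`.
    have hray : Tendsto (fun t : ℝ => EuclideanSpace.single i₀ t) atTop
        (Bornology.cobounded (EuclideanSpace ℝ (Fin n))) := by
      rw [← tendsto_norm_atTop_iff_cobounded]
      simpa using tendsto_abs_atTop_atTop
    obtain ⟨t, ht⟩ := ((hcoe.comp hray).eventually_gt_atTop 0).exists
    rw [Function.comp_apply, hsingle] at ht
    exact pos_of_mul_pos_right ht (abs_nonneg t)
  refine ⟨c, hcpos, funext fun x => le_antisymm ?_ ?_⟩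
  · have hsum : ∀ T : Finset (Fin n),
        R (∑ i ∈ T, EuclideanSpace.single i (x i)) ≤ ∑ i ∈ T, |x i| * c := by
      intro T
      induction T using Finset.induction_on with
      | empty => simpa using (hh 0 0 le_rfl).le
      | insert i T hi ih =>
        rw [Finset.sum_insert hi, Finset.sum_insert hi, ← hsingle i]
        exact (add_le_of_convexOn_of_homogeneous hconv hh _ _).trans (by gcongr)
    have hx : ∑ i, EuclideanSpace.single i (x i) = x := by
      ext j; simp [Finset.sum_apply]
    have := hsum Finset.univ
    rw [hx, ← Finset.sum_mul] at this
    rwa [mul_comm, l1Norm]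
  -- Each atom is a multiple of a unit vector, where `R` and `c‖·‖₁` agree, and `R ≤ 1` on atoms;
  -- hence `c‖·‖₁` lies below the atomic norm.
  · rw [← EReal.coe_le_coe_iff, hRA x]
    have hcc := smul_l1Norm_mem_coerciveConvex (n := n) hcpos
    refine le_atomicNorm hcc.1 hcc.2.1 (fun t x ht => ?_) (fun a ha => ?_) x
    · rw [l1Norm_smul, abs_of_nonneg ht]; ring
    · have hle : R a ≤ 1 := by
        rw [← EReal.coe_le_coe_iff, hRA a]
        exact atomicNorm_le zero_le_one
          (by rw [one_smul]; exact subset_closure (subset_convexHull ℝ A ha))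
      obtain ⟨i, b, rfl⟩ := exists_eq_single_of_mem_sparseVectors_one (by omega) (hA ha)
      rw [l1Norm_single, mul_comm]
      rwa [hsingle] at hle

end OneSparse

theorem mainTheorem3 (n k : ℕ) (hk : 1 ≤ k) (hkn : 2 * k < n) :
    l1Norm n ∈ coerciveConvex (EuclideanSpace ℝ (Fin n)) ∧
    deltaSuff (sparseVectors n k) (l1Norm n) =
      (⨆ R ∈ coerciveConvex (EuclideanSpace ℝ (Fin n)), deltaSuff (sparseVectors n k) R) ∧
    (⨆ R ∈ coerciveConvex (EuclideanSpace ℝ (Fin n)), deltaSuff (sparseVectors n k) R) =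
      ((1 / √2 : ℝ) : EReal) ∧
    (k = 1 →
      {R | R ∈ coerciveAtomic (sparseVectors n k) ∧
          IsMaxOn (deltaSuff (sparseVectors n k)) (coerciveAtomic (sparseVectors n k)) R} =
        {R | ∃ c : ℝ, 0 < c ∧ R = fun x => c * l1Norm n x}) := by
  have hmem : l1Norm n ∈ coerciveConvex (EuclideanSpace ℝ (Fin n)) := by
    simpa using smul_l1Norm_mem_coerciveConvex (n := n) one_pos
  have hlow : ((1 / √2 : ℝ) : EReal) ≤ deltaSuff (sparseVectors n k) (l1Norm n) :=
    le_deltaSuff_l1Norm hk (by omega)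
  have hup := fun R => deltaSuff_sparseVectors_le (n := n) hk hkn.le R
  have hsup : (⨆ R ∈ coerciveConvex (EuclideanSpace ℝ (Fin n)),
      deltaSuff (sparseVectors n k) R) = ((1 / √2 : ℝ) : EReal) :=
    le_antisymm (iSup₂_le fun R _ => hup R) (le_iSup₂_of_le _ hmem hlow)
  refine ⟨hmem, by rw [hsup]; exact le_antisymm (hup _) hlow, hsup, ?_⟩
  rintro rfl
  ext R
  constructor
  · rintro ⟨hR, hmax⟩
    refine eq_const_mul_l1Norm_of_le_deltaSuff (by omega) hR ?_
    have h1 := hmax (const_mul_l1Norm_mem_coerciveAtomic (n := n) le_rfl one_pos)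
    rw [Set.mem_ofPred_eq, deltaSuff_const_mul one_pos] at h1
    exact hlow.trans h1
  · rintro ⟨c, hc, rfl⟩
    refine ⟨const_mul_l1Norm_mem_coerciveAtomic le_rfl hc, fun R' _ => ?_⟩
    rw [Set.mem_ofPred_eq, deltaSuff_const_mul hc]
    exact (hup R').trans hlow
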